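/- **Setting.** There are $n=2t+1$ replicas. Every view $i\in\mathbb N$ has a publicly known synchronous group $sg_i$ of $t+1$ (active) replicas, one of which is the primary $ps_i$; the others are its followers. Channels are asynchronous: messages can be arbitrarily delayed, reordered, duplicated or lost, and timers can expire at any time. A replica is *benign* if it is correct or crash-faulty, that is, if it follows the protocol until it possibly stops; every other replica, and every client, may send arbitrary messages, but cannot forge signatures of others. Digests $D$ are collision-free. **Protocol (XPaxos with fault detection).** Each replica has a prepare log and a commit log, indexed by sequence numbers $sn\ge 1$. *Common case of view $i$:* the primary assigns the next $sn$ to a client-signed request $req$, stores it in its prepare log with its signed message $\langle\mathrm{prepare},D(req),sn,i\rangle$ and sends both to the followers; a follower whose last sequence number is $sn-1$ stores them in its own prepare log and sends a signed $\langle\mathrm{commit},D(req),sn,i\rangle$ to the active replicas; an active replica that holds the prepare entry and the commits of all followers stores them in its commit log (if $t=1$, the follower does so as soon as it has prepared $req$). An entry is *generated in view $i$* if its signatures are for view $i$. *View change to $i$:* after a suspect message of an active replica of view $i-1$, a replica in view $i-1$ stops processing messages of that view, enters view $i$ and sends a signed view-change message with its commit log, its prepare log, and the final proof of the view in which this prepare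 log was generated (if any) to the replicas in $sg_i$; its own message is available to it at once. Each replica of $sg_i$ collects at least $n-t$ valid view-change messages and sends them in a vc-final message to $sg_i$; after the vc-final messages of all of $sg_i$ it merges these sets, runs the checks below, removes the messages of the replicas in its set $FSet$ of detected replicas, and sends a signed vc-confirm message with the digest of the remaining set $VCSet^i$. Vc-confirm messages of all of $sg_i$ with the same digest form the final proof of view $i$. Then, for each $sn$ up to the largest index in the logs of $VCSet^i$, a commit log entry and a prepare log entry of highest view are selected; the request for $sn$ is that of the former, unless it is null or the latter has a higher view, and then that of the latter. The primary replaces its prepare log by the selected requests, prepared in view $i$, and sends it in a new-view message (its own copy being processed at once); a follower accepts it only if it matches its own selection, then replaces its prepare log by it and signs the commits. Common-case processing of view $i$ starts only after that. **Checks in the view change to $i$**, for valid view-change messages $m$ of $s_k$ and $m'$ of $s_{k'}$ and a sequence number $sn$ ("valid" means that all signatures in them verify and all log entries are of views below $i$): - *state-loss:* for some $i'<i$ with $s_k,s_{k'}\in sg_{i'}$, $m'$ has a commit log entry at $sn$ generated in view $i'$, and the prepare log in $m$ has no entry at $sn$; - *fork-I:* for some $i'<i$ with $s_k,s_{k'}\in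 sg_{i'}$, $m'$ has a commit log entry at $sn$ generated in view $i'$, and the entry at $sn$ of the prepare log in $m$ is generated in view $i'$ for a different request, or in a view $i''<i'$; - *fork-II:* if the prepare log entry of $m$ at $sn$ is generated in a view $i''<i$, the commit log entry of $m'$ at $sn$ in a view below $i''$, and the former's request is null or the two requests differ, then $sg_{i''}$ is queried. A replica $s_j$ that receives a query about $m$, that was active in the view $i''$ of the final proof in $m$ and that holds a final proof of $i''$, answers with a fork-II message, containing $m$, its final proof and the vc-final messages of view $i''$, if the prepare log in $m$ at $sn$ is not consistent with its set $VCSet^{i''}$, i.e. if the selection from this set covers $sn$ but cannot yield the request stored there (or nothing is stored there). State-loss and fork-I checks that fire are announced to all replicas in messages containing $m$ and $m'$; replicas forward state-loss, fork-I and fork-II messages whose evidence verifies. A replica adds $s_k$ to $FSet$ when its state-loss or fork-I check fires for $s_k$, or when it receives a fork-II message about $s_k$ whose evidence verifies (the two view-change messages are valid and satisfy the condition; for fork-II, $m$ is valid and carries a final proof of view $i''$, the vc-final messages of all of $sg_{i''}$ and a final proof of $i''$ are present, the final proof's digest is that of the union of the sets in these vc-final messages after removal of the messages of some replicas, and the prepare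 log in $m$ at $sn$ is not consistent with the resulting set). **Theorem 6 (strong accuracy of fault detection).** If a replica $s_k$ is benign, then XPaxos fault detection never detects $s_k$ as faulty. That is, at every moment of every execution: $s_k$ is in the set $FSet$ of no benign replica; no benign replica has sent or forwarded a state-loss, fork-I or fork-II message about $s_k$; and from the messages sent so far no verifiable state-loss, fork-I or fork-II evidence against $s_k$ can be formed. -/

import Mathlib

namespace XPaxos

/-! ### Logs, certificates and messages -/

/-- An array indexed by sequence numbers, with finitely many non-`nil` cells. -/
structure Log (E : Type*) where
  get : ℕ → Option E
  finite : ∃ N, ∀ n, N < n → get n = none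

namespace Log

/-- The empty array. -/
def empty (E : Type*) : Log E := ⟨fun _ => none, 0, fun _ _ => rfl⟩

/-- Assignment `L[n] ← e`. -/
def set {E : Type*} (L : Log E) (n : ℕ) (e : E) : Log E where
  get := Function.update L.get n (some e)
  finite := by
    obtain ⟨N, hN⟩ := L.finite
    refine ⟨max N n, fun k hk => ?_⟩
    have h1 : k ≠ n := by omega
    rw [Function.update_of_ne h1]
    exact hN k (by omega)

/-- The array with `L[n] = f n` for `n = 1, …, N` and no other entry. -/
def tabulate {E : Type*} (N : ℕ) (f : ℕ → E) : Log E where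
  get n := if 1 ≤ n ∧ n ≤ N then some (f n) else none
  finite := ⟨N, fun n hn => if_neg (by omega)⟩

/-- `L` overwritten by the entries of `L'`. -/
def override {E : Type*} (L L' : Log E) : Log E where
  get n := (L'.get n).or (L.get n)
  finite := by
    obtain ⟨N, hN⟩ := L.finite
    obtain ⟨N', hN'⟩ := L'.finite
    refine ⟨max N N', fun k hk => ?_⟩
    rw [hN k (by omega), hN' k (by omega)]
    rfl

/-- The end index of the array (`0` if it is empty). -/
noncomputable def last {E : Type*} (L : Log E) : ℕ := sSup {n | L.get n ≠ none}

end Log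

/-- The content of a log entry: a request (`none` is the null request, which fills a gap) and the
view in which the entry was generated; its sequence number is its index in the log.
As an entry of a prepare log it stands for the request together with the primary's signed `prepare`
for it (`PrepareCert`); as an entry of a commit log it stands, in addition, for the signed `commit`
messages of all followers of that view (`CommitCert`). -/
structure Entry (Req : Type*) where
  req : Option Req
  view : ℕ

/-- `t + 1` signed `vc-confirm` messages, one from every active replica of `view`, all with the same
digest (`FinalProofCert` says that these signatures exist). -/
structure FinalProof (Dg : Type*) where
  view : ℕ
  digest : Dg

/-- A `view-change` message, with the fields used when fault detection is enabled. -/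
structure VCMsg (P Req Dg : Type*) where
  view : ℕ
  sender : P
  commitLog : Log (Entry Req)
  prepareLog : Log (Entry Req)
  finalProof : Option (FinalProof Dg)

/-- The messages exchanged by replicas (without the sender). -/
inductive Payload (P Req Dg : Type*)
  | prepare (d : Dg) (sn i : ℕ)
  | commit (d : Dg) (sn i : ℕ)
  | suspect (i : ℕ)
  | viewChange (m : VCMsg P Req Dg)
  | vcFinal (i : ℕ) (V : Finset (VCMsg P Req Dg))
  | vcConfirm (i : ℕ) (d : Dg)
  | newView (i : ℕ) (L : Log (Entry Req))
  | stateLoss (i : ℕ) (k : P) (sn : ℕ) (m m' : VCMsg P Req Dg)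
  | forkI (i : ℕ) (k : P) (sn : ℕ) (m m' : VCMsg P Req Dg)
  | forkIIQuery (i : ℕ) (k : P) (sn : ℕ) (m : VCMsg P Req Dg)
  | forkII (i : ℕ) (k : P) (sn : ℕ) (m : VCMsg P Req Dg) (fp : FinalProof Dg)
      (finalSet : P → Finset (VCMsg P Req Dg))

/-- The public parameters: `n = 2 t + 1` replicas, the synchronous group (`t + 1` replicas) and the
primary of every view, and digests (of requests and of sets of `view-change` messages) that nobody
can make collide. -/
structure Config (P Req Dg : Type*) [Fintype P] where
  t : ℕ
  card_replicas : Fintype.card P = 2 * t + 1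
  sg : ℕ → Finset P
  card_sg : ∀ i, (sg i).card = t + 1
  ps : ℕ → P
  ps_mem : ∀ i, ps i ∈ sg i
  digReq : Option Req → Dg
  digReq_injective : Function.Injective digReq
  digVC : Finset (VCMsg P Req Dg) → Dg
  digVC_injective : Function.Injective digVC

/-! ### States -/

/-- Progress of a replica inside its current view. -/
inductive Phase
  /-- collecting `view-change` messages -/
  | collecting
  /-- `vc-final` sent, waiting for those of the others -/
  | finalizing
  /-- fault detection was run, waiting for the outcome of its queries -/
  | detecting
  /-- `vc-confirm` sent, waiting for those of the others -/
  | confirming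
  /-- follower that waits for the `new-view` message -/
  | awaitingNewView
  /-- common case -/
  | normal

/-- The local state of a replica. -/
structure LState (P Req Dg : Type*) where
  crashed : Prop
  view : ℕ
  phase : Phase
  sn : ℕ
  prepareLog : Log (Entry Req)
  commitLog : Log (Entry Req)
  /-- the view in which `prepareLog` was generated -/
  pre : ℕ
  /-- for each view, the `view-change` messages collected for it -/
  vcSet : ℕ → Finset (VCMsg P Req Dg)
  /-- for each view, the sets in the `t + 1` `vc-final` messages received -/
  finalSet : ℕ → P → Finset (VCMsg P Req Dg)
  /-- for each view, the digest in the `t + 1` matching `vc-confirm` messages received -/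
  finalProof : ℕ → Option Dg
  /-- most recent commit log entries selected in the current view change -/
  selCommit : Log (Entry Req)
  /-- most recent prepare log entries selected in the current view change -/
  selPrepare : Log (Entry Req)
  /-- replicas detected as faulty -/
  fset : Set P

/-- The global state. `sent` holds every message sent so far, with its sender; a message in it may be
received by anyone, any number of times, at any later moment, or never. The signature of `s` on a
statement verifies exactly if `s` has sent that statement. `issued` holds the requests signed by
clients so far. -/
structure State (P Req Dg : Type*) where
  loc : P → LState P Req Dg
  sent : Set (P × Payload P Req Dg)
  issued : Set Req

/-- All replicas start in the common case of view `0`. -/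
def LState.init (P Req Dg : Type*) : LState P Req Dg where
  crashed := False
  view := 0
  phase := .normal
  sn := 0
  prepareLog := Log.empty _
  commitLog := Log.empty _
  pre := 0
  vcSet := fun _ => ∅
  finalSet := fun _ _ => ∅
  finalProof := fun _ => none
  selCommit := Log.empty _
  selPrepare := Log.empty _
  fset := ∅

def State.init (P Req Dg : Type*) : State P Req Dg where
  loc := fun _ => LState.init P Req Dg
  sent := ∅
  issued := ∅

open scoped Classical in
/-- Replica `j` moves to local state `l` and sends the messages in `out`. -/
noncomputable def State.next {P Req Dg : Type*} (σ : State P Req Dg) (j : P)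
    (l : LState P Req Dg) (out : Set (Payload P Req Dg)) : State P Req Dg where
  loc := Function.update σ.loc j l
  sent := σ.sent ∪ {x | x.1 = j ∧ x.2 ∈ out}
  issued := σ.issued

/-! ### Verification of certificates -/

section Checks

variable {P Req Dg : Type*} [Fintype P] (cfg : Config P Req Dg)

/-- The primary of the entry's view has signed a `prepare` for it, and the client has signed the
request (unless it is the null request). -/
def PrepareCert (σ : State P Req Dg) (sn : ℕ) (e : Entry Req) : Prop :=
  (cfg.ps e.view, Payload.prepare (cfg.digReq e.req) sn e.view) ∈ σ.sent ∧
    ∀ r, e.req = some r → r ∈ σ.issued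

/-- In addition, every follower of the entry's view has signed a `commit` for it. -/
def CommitCert (σ : State P Req Dg) (sn : ℕ) (e : Entry Req) : Prop :=
  PrepareCert cfg σ sn e ∧ ∀ s ∈ cfg.sg e.view, s ≠ cfg.ps e.view →
    (s, Payload.commit (cfg.digReq e.req) sn e.view) ∈ σ.sent

def FinalProofCert (σ : State P Req Dg) (fp : FinalProof Dg) : Prop :=
  ∀ s ∈ cfg.sg fp.view, (s, Payload.vcConfirm fp.view fp.digest) ∈ σ.sent

/-- The `view-change` message `m` is signed by its sender and all certificates in it verify. -/
def ValidVC (σ : State P Req Dg) (m : VCMsg P Req Dg) : Prop :=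
  (m.sender, Payload.viewChange m) ∈ σ.sent ∧
  (∀ sn e, m.commitLog.get sn = some e → e.view < m.view ∧ CommitCert cfg σ sn e) ∧
  (∀ sn e, m.prepareLog.get sn = some e → e.view < m.view ∧ PrepareCert cfg σ sn e) ∧
  (∀ fp, m.finalProof = some fp → FinalProofCert cfg σ fp)

/-! ### Selection of the requests of a new view -/

/-- `o` is an entry at `sn` with the highest view number among the logs `log m`, `m ∈ V`
(`none` if none of them has an entry at `sn`). -/
def IsHighest (V : Finset (VCMsg P Req Dg)) (log : VCMsg P Req Dg → Log (Entry Req)) (sn : ℕ)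
    (o : Option (Entry Req)) : Prop :=
  (o = none → ∀ m ∈ V, (log m).get sn = none) ∧
  (∀ e, o = some e → (∃ m ∈ V, (log m).get sn = some e) ∧
    ∀ m ∈ V, ∀ e', (log m).get sn = some e' → e'.view ≤ e.view)

open scoped Classical in
/-- The request to be prepared, given the selected commit log entry `c` and prepare log entry `p`:
that of `c`, unless it is null or `p` was generated in a higher view. -/
noncomputable def selectReq (c p : Option (Entry Req)) : Option Req :=
  let req := c.bind Entry.req
  if req = none ∨ ∃ ce pe, c = some ce ∧ p = some pe ∧ ce.view < pe.view then
    p.bind Entry.req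
  else req

/-- The prepare log of view `i`, built from the selected commit and prepare log entries. -/
noncomputable def newLog (i : ℕ) (C L : Log (Entry Req)) : Log (Entry Req) :=
  Log.tabulate (max C.last L.last) fun sn => ⟨selectReq (C.get sn) (L.get sn), i⟩

/-- `o`, the cell of a prepare log at `sn`, is consistent with the set `V` of `view-change`
messages: if `sn` is among the sequence numbers `1, …, End` covered by the logs in `V`, then `o`
is an entry whose request is one that the selection from `V` can yield at `sn`. -/
def Consistent (V : Finset (VCMsg P Req Dg)) (sn : ℕ) (o : Option (Entry Req)) : Prop :=
  (1 ≤ sn ∧ ∃ n ≥ sn, ∃ m ∈ V, m.commitLog.get n ≠ none ∨ m.prepareLog.get n ≠ none) →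
    ∃ e c p, o = some e ∧ IsHighest V VCMsg.commitLog sn c ∧ IsHighest V VCMsg.prepareLog sn p ∧
      e.req = selectReq c p

open scoped Classical in
/-- `V` without the messages of the replicas in `F`. -/
noncomputable def removeFaulty (V : Finset (VCMsg P Req Dg)) (F : Set P) :
    Finset (VCMsg P Req Dg) :=
  V.filter fun m => m.sender ∉ F

open scoped Classical in
/-- The union of the sets in the `vc-final` messages of all active replicas of view `i`. -/
noncomputable def unionFinal (i : ℕ) (S : P → Finset (VCMsg P Req Dg)) :
    Finset (VCMsg P Req Dg) :=
  (cfg.sg i).biUnion S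

/-! ### The fault detection checks -/

/-- In the view change to `i`: the sender of `m` was active in some earlier view `i'`, in which a
request was committed at `sn` according to `m'`, but the prepare log in `m` has no entry at `sn`. -/
def StateLoss (i sn : ℕ) (m m' : VCMsg P Req Dg) : Prop :=
  ∃ i' < i, m.sender ∈ cfg.sg i' ∧ m'.sender ∈ cfg.sg i' ∧
    (∃ c, m'.commitLog.get sn = some c ∧ c.view = i') ∧ m.prepareLog.get sn = none

/-- In the view change to `i`: the sender of `m` was active in some earlier view `i'`, in which a
request was committed at `sn` according to `m'`, but the entry at `sn` of the prepare log in `m` was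
generated in view `i'` for another request, or in a view below `i'`. -/
def ForkI (i sn : ℕ) (m m' : VCMsg P Req Dg) : Prop :=
  ∃ i' < i, m.sender ∈ cfg.sg i' ∧ m'.sender ∈ cfg.sg i' ∧
    ∃ e c, m.prepareLog.get sn = some e ∧ m'.commitLog.get sn = some c ∧ c.view = i' ∧
      ((e.view = i' ∧ e.req ≠ c.req) ∨ e.view < i')

/-- In the view change to `i`: the prepare log in `m` has at `sn` an entry of a view `i'' < i` that
differs from what was committed at `sn` in a view below `i''` according to `m'`. -/
def ForkIISuspicion (i sn : ℕ) (m m' : VCMsg P Req Dg) : Prop :=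
  ∃ e c, m.prepareLog.get sn = some e ∧ m'.commitLog.get sn = some c ∧
    c.view < e.view ∧ e.view < i ∧ (e.req = none ∨ e.req ≠ c.req)

/-- `m` and `m'` are verifiable evidence of a state-loss fault of `k`. -/
def StateLossEvidence (σ : State P Req Dg) (i : ℕ) (k : P) (sn : ℕ) (m m' : VCMsg P Req Dg) :
    Prop :=
  ValidVC cfg σ m ∧ ValidVC cfg σ m' ∧ m.view = i ∧ m'.view = i ∧ m.sender = k ∧
    StateLoss cfg i sn m m'

/-- `m` and `m'` are verifiable evidence of a fork-I fault of `k`. -/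
def ForkIEvidence (σ : State P Req Dg) (i : ℕ) (k : P) (sn : ℕ) (m m' : VCMsg P Req Dg) : Prop :=
  ValidVC cfg σ m ∧ ValidVC cfg σ m' ∧ m.view = i ∧ m'.view = i ∧ m.sender = k ∧
    ForkI cfg i sn m m'

/-- Verifiable evidence of a fork-II fault of `k`: the prepare log in its `view-change` message `m`,
which carries a final proof of view `i'' = fp.view`, is not consistent at `sn` with the set of
`view-change` messages that all active replicas of view `i''` have confirmed, that is, the union of
the sets in their `vc-final` messages without the messages of the replicas found faulty. -/
def ForkIIEvidence (σ : State P Req Dg) (i : ℕ) (k : P) (sn : ℕ) (m : VCMsg P Req Dg)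
    (fp : FinalProof Dg) (S : P → Finset (VCMsg P Req Dg)) : Prop :=
  ValidVC cfg σ m ∧ m.view = i ∧ m.sender = k ∧
    (∃ fp', m.finalProof = some fp' ∧ fp'.view = fp.view) ∧ FinalProofCert cfg σ fp ∧
    (∀ s ∈ cfg.sg fp.view, (s, Payload.vcFinal fp.view (S s)) ∈ σ.sent) ∧
    ∃ F : Set P, cfg.digVC (removeFaulty (unionFinal cfg fp.view S) F) = fp.digest ∧
      ¬ Consistent (removeFaulty (unionFinal cfg fp.view S) F) sn (m.prepareLog.get sn)

/-! ### The protocol -/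

/-- The `view-change` message with which replica `j` in local state `l` enters view `l.view + 1`. -/
def vcMsg (j : P) (l : LState P Req Dg) : VCMsg P Req Dg where
  view := l.view + 1
  sender := j
  commitLog := l.commitLog
  prepareLog := l.prepareLog
  finalProof := (l.finalProof l.pre).map fun d => ⟨l.pre, d⟩

/-- The commit log of replica `j` after it has prepared the entries of `L` in view `i`: if `t = 1`,
the follower commits a request as soon as it has prepared it. -/
def commitAtOnce (j : P) (i : ℕ) (C L : Log (Entry Req)) (C' : Log (Entry Req)) : Prop :=
  (cfg.t = 1 ∧ j ≠ cfg.ps i ∧ C' = C.override L) ∨ (¬ (cfg.t = 1 ∧ j ≠ cfg.ps i) ∧ C' = C)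

open scoped Classical in
/-- `Handler cfg σ j l' out`: in the global state `σ`, one of the event handlers of the protocol with
fault detection can take replica `j` to the local state `l'`, sending the messages in `out`.
Messages that a replica sends to itself in `enterView` and `startPrimary` are processed at once.
Timers may expire, and views may be suspected, at any moment. Executing requests and answering
clients do not affect the rest of the protocol and are left out. -/
inductive Handler (σ : State P Req Dg) (j : P) :
    LState P Req Dg → Set (Payload P Req Dg) → Prop
  /-- The primary orders a client request. -/
  | order (r : Req) (hj : j = cfg.ps (σ.loc j).view) (hph : (σ.loc j).phase = .normal)
      (hr : r ∈ σ.issued) :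
      Handler σ j
        { σ.loc j with
          sn := (σ.loc j).sn + 1
          prepareLog := (σ.loc j).prepareLog.set ((σ.loc j).sn + 1) ⟨some r, (σ.loc j).view⟩ }
        {.prepare (cfg.digReq (some r)) ((σ.loc j).sn + 1) (σ.loc j).view}
  /-- A follower receives a request with the primary's `prepare` for it. -/
  | follow (r : Req) (C : Log (Entry Req)) (hj : j ∈ cfg.sg (σ.loc j).view)
      (hne : j ≠ cfg.ps (σ.loc j).view) (hph : (σ.loc j).phase = .normal) (hr : r ∈ σ.issued)
      (hp : (cfg.ps (σ.loc j).view,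
        .prepare (cfg.digReq (some r)) ((σ.loc j).sn + 1) (σ.loc j).view) ∈ σ.sent)
      (hC : commitAtOnce cfg j (σ.loc j).view (σ.loc j).commitLog
        ((Log.empty _).set ((σ.loc j).sn + 1) ⟨some r, (σ.loc j).view⟩) C) :
      Handler σ j
        { σ.loc j with
          sn := (σ.loc j).sn + 1
          prepareLog := (σ.loc j).prepareLog.set ((σ.loc j).sn + 1) ⟨some r, (σ.loc j).view⟩
          commitLog := C }
        {.commit (cfg.digReq (some r)) ((σ.loc j).sn + 1) (σ.loc j).view}
  /-- An active replica has a prepare log entry and the matching `commit`s of all followers. -/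
  | commit (sn : ℕ) (e : Entry Req) (hj : j ∈ cfg.sg (σ.loc j).view)
      (hph : (σ.loc j).phase = .normal) (he : (σ.loc j).prepareLog.get sn = some e)
      (hc : ∀ s ∈ cfg.sg (σ.loc j).view, s ≠ cfg.ps (σ.loc j).view →
        (s, .commit (cfg.digReq e.req) sn (σ.loc j).view) ∈ σ.sent) :
      Handler σ j
        { σ.loc j with commitLog := (σ.loc j).commitLog.set sn ⟨e.req, (σ.loc j).view⟩ } ∅
  /-- An active replica suspects its view. -/
  | suspect (hj : j ∈ cfg.sg (σ.loc j).view) :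
      Handler σ j (σ.loc j) {.suspect (σ.loc j).view}
  /-- After a `suspect` message of an active replica for the current view, enter the next view. -/
  | enterView (k : P) (hk : k ∈ cfg.sg (σ.loc j).view)
      (hs : (k, .suspect (σ.loc j).view) ∈ σ.sent) :
      Handler σ j
        { σ.loc j with
          view := (σ.loc j).view + 1
          phase := .collecting
          vcSet := Function.update (σ.loc j).vcSet ((σ.loc j).view + 1) {vcMsg j (σ.loc j)} }
        {.viewChange (vcMsg j (σ.loc j))}
  /-- An active replica of the new view receives a `view-change` message. -/
  | recvViewChange (m : VCMsg P Req Dg) (hj : j ∈ cfg.sg (σ.loc j).view)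
      (hph : (σ.loc j).phase = .collecting) (hv : m.view = (σ.loc j).view)
      (hm : ValidVC cfg σ m) :
      Handler σ j
        { σ.loc j with
          vcSet := Function.update (σ.loc j).vcSet (σ.loc j).view
            (insert m ((σ.loc j).vcSet (σ.loc j).view)) } ∅
  /-- At least `n - t` `view-change` messages were collected (and the timer has expired, or all `n`
  were). -/
  | sendFinal (hj : j ∈ cfg.sg (σ.loc j).view) (hph : (σ.loc j).phase = .collecting)
      (hn : Fintype.card P - cfg.t ≤ ((σ.loc j).vcSet (σ.loc j).view).card) :
      Handler σ j { σ.loc j with phase := .finalizing }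
        {.vcFinal (σ.loc j).view ((σ.loc j).vcSet (σ.loc j).view)}
  /-- The `vc-final` messages of all active replicas have arrived: merge the sets in them and run
  fault detection on the result `V`. -/
  | detect (S : P → Finset (VCMsg P Req Dg)) (V : Finset (VCMsg P Req Dg))
      (hj : j ∈ cfg.sg (σ.loc j).view) (hph : (σ.loc j).phase = .finalizing)
      (hS : ∀ s ∈ cfg.sg (σ.loc j).view, (s, .vcFinal (σ.loc j).view (S s)) ∈ σ.sent ∧
        ∀ m ∈ S s, m.view = (σ.loc j).view ∧ ValidVC cfg σ m)
      (hV : V = (σ.loc j).vcSet (σ.loc j).view ∪ unionFinal cfg (σ.loc j).view S) :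
      Handler σ j
        { σ.loc j with
          phase := .detecting
          vcSet := Function.update (σ.loc j).vcSet (σ.loc j).view V
          finalSet := Function.update (σ.loc j).finalSet (σ.loc j).view S
          fset := (σ.loc j).fset ∪ {k | ∃ sn, ∃ m ∈ V, ∃ m' ∈ V, m.sender = k ∧
            (StateLoss cfg (σ.loc j).view sn m m' ∨ ForkI cfg (σ.loc j).view sn m m')} }
        {p | ∃ sn, ∃ m ∈ V, ∃ m' ∈ V,
          (StateLoss cfg (σ.loc j).view sn m m' ∧
            p = .stateLoss (σ.loc j).view m.sender sn m m') ∨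
          (ForkI cfg (σ.loc j).view sn m m' ∧ p = .forkI (σ.loc j).view m.sender sn m m') ∨
          (ForkIISuspicion (σ.loc j).view sn m m' ∧
            p = .forkIIQuery (σ.loc j).view m.sender sn m)}
  /-- Remove the messages of the replicas detected as faulty, and confirm the remaining set. -/
  | confirm (V : Finset (VCMsg P Req Dg)) (hj : j ∈ cfg.sg (σ.loc j).view)
      (hph : (σ.loc j).phase = .detecting)
      (hV : V = removeFaulty ((σ.loc j).vcSet (σ.loc j).view) (σ.loc j).fset) :
      Handler σ j
        { σ.loc j with
          phase := .confirming
          vcSet := Function.update (σ.loc j).vcSet (σ.loc j).view V }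
        {.vcConfirm (σ.loc j).view (cfg.digVC V)}
  /-- Matching `vc-confirm` messages of all active replicas have arrived at a follower. -/
  | startFollower (d : Dg) (C L : Log (Entry Req)) (hj : j ∈ cfg.sg (σ.loc j).view)
      (hne : j ≠ cfg.ps (σ.loc j).view) (hph : (σ.loc j).phase = .confirming)
      (hd : FinalProofCert cfg σ ⟨(σ.loc j).view, d⟩)
      (hC : ∀ sn, IsHighest ((σ.loc j).vcSet (σ.loc j).view) VCMsg.commitLog sn (C.get sn))
      (hL : ∀ sn, IsHighest ((σ.loc j).vcSet (σ.loc j).view) VCMsg.prepareLog sn (L.get sn)) :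
      Handler σ j
        { σ.loc j with
          phase := .awaitingNewView
          finalProof := Function.update (σ.loc j).finalProof (σ.loc j).view (some d)
          selCommit := C
          selPrepare := L } ∅
  /-- Matching `vc-confirm` messages of all active replicas have arrived at the primary, which
  prepares the selected requests. -/
  | startPrimary (d : Dg) (C L : Log (Entry Req)) (hj : j = cfg.ps (σ.loc j).view)
      (hph : (σ.loc j).phase = .confirming)
      (hd : FinalProofCert cfg σ ⟨(σ.loc j).view, d⟩)
      (hC : ∀ sn, IsHighest ((σ.loc j).vcSet (σ.loc j).view) VCMsg.commitLog sn (C.get sn))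
      (hL : ∀ sn, IsHighest ((σ.loc j).vcSet (σ.loc j).view) VCMsg.prepareLog sn (L.get sn)) :
      Handler σ j
        { σ.loc j with
          phase := .normal
          finalProof := Function.update (σ.loc j).finalProof (σ.loc j).view (some d)
          selCommit := C
          selPrepare := L
          prepareLog := newLog (σ.loc j).view C L
          sn := (newLog (σ.loc j).view C L).last
          pre := (σ.loc j).view }
        ({.newView (σ.loc j).view (newLog (σ.loc j).view C L)} ∪
          {p | ∃ sn e, (newLog (σ.loc j).view C L).get sn = some e ∧
            p = .prepare (cfg.digReq e.req) sn (σ.loc j).view})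
  /-- A follower receives a `new-view` message that matches its own selection, and processes the
  prepare log in it as in the common case. -/
  | recvNewView (L C : Log (Entry Req)) (hj : j ∈ cfg.sg (σ.loc j).view)
      (hne : j ≠ cfg.ps (σ.loc j).view) (hph : (σ.loc j).phase = .awaitingNewView)
      (hs : (cfg.ps (σ.loc j).view, .newView (σ.loc j).view L) ∈ σ.sent)
      (hp : ∀ sn e, L.get sn = some e → PrepareCert cfg σ sn e)
      (hL : L = newLog (σ.loc j).view (σ.loc j).selCommit (σ.loc j).selPrepare)
      (hC : commitAtOnce cfg j (σ.loc j).view (σ.loc j).commitLog L C) :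
      Handler σ j
        { σ.loc j with
          phase := .normal
          prepareLog := L
          commitLog := C
          sn := L.last
          pre := (σ.loc j).view }
        {p | ∃ sn e, L.get sn = some e ∧ p = .commit (cfg.digReq e.req) sn (σ.loc j).view}
  /-- A `fork-ii-query` arrives at a replica that was active in the view of the final proof in `m`,
  and that finds the prepare log in `m` inconsistent with the set it has confirmed in that view. -/
  | recvQuery (s : P) (i : ℕ) (k : P) (sn : ℕ) (m : VCMsg P Req Dg) (fp : FinalProof Dg) (d : Dg)
      (hs : (s, .forkIIQuery i k sn m) ∈ σ.sent) (hm : ValidVC cfg σ m) (hi : m.view = i)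
      (hk : m.sender = k) (hfp : m.finalProof = some fp) (hj : j ∈ cfg.sg fp.view)
      (hd : (σ.loc j).finalProof fp.view = some d)
      (hc : ¬ Consistent ((σ.loc j).vcSet fp.view) sn (m.prepareLog.get sn)) :
      Handler σ j (σ.loc j) {.forkII i k sn m ⟨fp.view, d⟩ ((σ.loc j).finalSet fp.view)}
  /-- Reception of a `fork-ii` message whose evidence verifies. -/
  | recvForkII (s : P) (i : ℕ) (k : P) (sn : ℕ) (m : VCMsg P Req Dg) (fp : FinalProof Dg)
      (S : P → Finset (VCMsg P Req Dg)) (hs : (s, .forkII i k sn m fp S) ∈ σ.sent)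
      (he : ForkIIEvidence cfg σ i k sn m fp S) :
      Handler σ j { σ.loc j with fset := insert k (σ.loc j).fset } {.forkII i k sn m fp S}
  /-- Reception and forwarding of a `state-loss` message whose evidence verifies. -/
  | recvStateLoss (s : P) (i : ℕ) (k : P) (sn : ℕ) (m m' : VCMsg P Req Dg)
      (hs : (s, .stateLoss i k sn m m') ∈ σ.sent) (he : StateLossEvidence cfg σ i k sn m m') :
      Handler σ j (σ.loc j) {.stateLoss i k sn m m'}
  /-- Reception and forwarding of a `fork-i` message whose evidence verifies. -/
  | recvForkI (s : P) (i : ℕ) (k : P) (sn : ℕ) (m m' : VCMsg P Req Dg)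
      (hs : (s, .forkI i k sn m m') ∈ σ.sent) (he : ForkIEvidence cfg σ i k sn m m') :
      Handler σ j (σ.loc j) {.forkI i k sn m m'}

/-- One step of the system, in which exactly the replicas in `B` are benign. -/
inductive Step (B : Set P) : State P Req Dg → State P Req Dg → Prop
  /-- A benign replica that has not crashed executes an event handler. -/
  | handle (σ : State P Req Dg) (j : P) (hj : j ∈ B) (hc : ¬ (σ.loc j).crashed)
      (l : LState P Req Dg) (out : Set (Payload P Req Dg)) (h : Handler cfg σ j l out) :
      Step B σ (σ.next j l out)
  /-- A benign replica crashes. -/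
  | crash (σ : State P Req Dg) (j : P) (hj : j ∈ B) :
      Step B σ (σ.next j { σ.loc j with crashed := True } ∅)
  /-- A replica that is not benign sends an arbitrary message (but under its own name only). -/
  | arbitrary (σ : State P Req Dg) (s : P) (hs : s ∉ B) (p : Payload P Req Dg) :
      Step B σ { σ with sent := insert (s, p) σ.sent }
  /-- A (correct or faulty) client signs a request. -/
  | request (σ : State P Req Dg) (r : Req) :
      Step B σ { σ with issued := insert r σ.issued }

/-- `σ` occurs in an execution in which exactly the replicas in `B` are benign. -/
def Reachable (B : Set P) (σ : State P Req Dg) : Prop :=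
  Relation.ReflTransGen (Step cfg B) (State.init P Req Dg) σ

end Checks

end XPaxos

/-! Every verifiable accusation of `k` rests on statements signed by `k` itself. So it is enough to
control what a benign replica signs and stores (`LocalInv`), while the replicas outside `B` sign
whatever they like.

State-loss and fork-I: a commit certificate of a view in which `k` was active contains a `prepare`
or `commit` of `k`. A benign replica keeps a trace of all that it has ordered: at that index its
prepare log has the same digest in the same view, or an entry of a later view. In the common case
only a fresh index is written. In a view change the replica's own `view-change` message is in the
set from which the new log is selected, so the new log covers every index ordered before, with
entries of a higher view; which request is selected there is irrelevant. This gives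
`LocalInv.not_stateLoss` and `LocalInv.not_forkI`.

Fork-II: a final proof of a view contains the `vc-confirm` of each of its active replicas. As
digests are injective, they all confirmed one set, the one stored by `k`. The prepare log of `k` was
selected from this set, and later appends lie beyond the indices that the set covers
(`LocalInv.consistent_of_confirmed`).

The two halves depend on each other: a replica's own message survives the removal of detected
replicas only if the replica has not detected itself. Hence `Inv` proves the local invariants and
accuracy in one induction: accuracy before a step gives the local invariants after it
(`LocalInv.handler`), and the local invariants before it exclude new accusations
(`Inv.handler_accurate`). -/

namespace XPaxos

/-! ### Ends of finite logs -/

namespace Log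

variable {E : Type*}

theorem le_last {L : Log E} {n : ℕ} (h : L.get n ≠ none) : n ≤ L.last := by
  obtain ⟨N, hN⟩ := L.finite
  refine le_csSup ⟨N, fun k hk => ?_⟩ h
  by_contra hlt
  exact hk (hN k (by omega))

theorem tabulate_get (N : ℕ) (f : ℕ → E) (n : ℕ) :
    (tabulate N f).get n = if 1 ≤ n ∧ n ≤ N then some (f n) else none := rfl

theorem le_last_tabulate {N : ℕ} {f : ℕ → E} {n : ℕ} (h : n ≤ N) : n ≤ (tabulate N f).last := by
  rcases Nat.eq_zero_or_pos n with rfl | hn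
  · exact Nat.zero_le _
  · exact le_last (by simp [tabulate_get, Nat.one_le_iff_ne_zero.mpr hn.ne', h])

end Log

/-! ### Coverage and consistency of the selected prepare log -/

section Selection

variable {P Req Dg : Type*}

theorem IsHighest.ne_none {V : Finset (VCMsg P Req Dg)} {log : VCMsg P Req Dg → Log (Entry Req)}
    {n : ℕ} {o : Option (Entry Req)} (h : IsHighest V log n o) {m : VCMsg P Req Dg} (hm : m ∈ V)
    (hn : (log m).get n ≠ none) : o ≠ none :=
  fun ho => hn (h.1 ho m hm)

theorem newLog_get_eq_some {i : ℕ} {C L : Log (Entry Req)} {n : ℕ} {e : Entry Req} :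
    (newLog i C L).get n = some e ↔
      (1 ≤ n ∧ n ≤ max C.last L.last) ∧ e = ⟨selectReq (C.get n) (L.get n), i⟩ := by
  unfold newLog
  rw [Log.tabulate_get]
  split_ifs with h
  · simp [h, eq_comm]
  · exact ⟨fun h' => (nomatch h'), fun h' => absurd h'.1 h⟩

/-- A highest entry exists wherever some collected log has an entry, so the new log is at least as
long as every log in `V`. This is why nothing ordered earlier gets lost. -/
theorem le_last_of_covered {V : Finset (VCMsg P Req Dg)} {C L : Log (Entry Req)}
    (hC : ∀ n, IsHighest V VCMsg.commitLog n (C.get n))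
    (hL : ∀ n, IsHighest V VCMsg.prepareLog n (L.get n)) {n : ℕ} {m : VCMsg P Req Dg} (hm : m ∈ V)
    (hn : m.commitLog.get n ≠ none ∨ m.prepareLog.get n ≠ none) : n ≤ max C.last L.last := by
  rcases hn with hn | hn
  · exact (Log.le_last ((hC n).ne_none hm hn)).trans (le_max_left _ _)
  · exact (Log.le_last ((hL n).ne_none hm hn)).trans (le_max_right _ _)

/-- The witnesses are the selections actually made. `Consistent` quantifies over selections because
entries of the same highest view may differ. -/
theorem consistent_newLog {V : Finset (VCMsg P Req Dg)} {C L : Log (Entry Req)}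
    (hC : ∀ n, IsHighest V VCMsg.commitLog n (C.get n))
    (hL : ∀ n, IsHighest V VCMsg.prepareLog n (L.get n)) (i n : ℕ) :
    Consistent V n ((newLog i C L).get n) := by
  rintro ⟨h1, k, hk, m, hm, hn⟩
  have hle := hk.trans (le_last_of_covered hC hL hm hn)
  exact ⟨_, C.get n, L.get n, newLog_get_eq_some.2 ⟨⟨h1, hle⟩, rfl⟩, hC n, hL n, rfl⟩

end Selection

/-! ### The local invariant of a benign replica -/

section Invariant

variable {P Req Dg : Type*}

/-- Replica `j` has signed a `prepare` or a `commit` with digest `d` at `n` in view `v`. -/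
def Ordered (sent : Set (P × Payload P Req Dg)) (j : P) (d : Dg) (n v : ℕ) : Prop :=
  (j, Payload.prepare d n v) ∈ sent ∨ (j, Payload.commit d n v) ∈ sent

variable [Fintype P] (cfg : Config P Req Dg)

/-- The signatures of replicas in a `CommitCert`. -/
def CommitSigned (sent : Set (P × Payload P Req Dg)) (n : ℕ) (e : Entry Req) : Prop :=
  (cfg.ps e.view, Payload.prepare (cfg.digReq e.req) n e.view) ∈ sent ∧
    ∀ s ∈ cfg.sg e.view, s ≠ cfg.ps e.view →
      (s, Payload.commit (cfg.digReq e.req) n e.view) ∈ sent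

variable {cfg}

theorem CommitSigned.mono {sent sent' : Set (P × Payload P Req Dg)} (h : sent ⊆ sent') {n : ℕ}
    {e : Entry Req} (hc : CommitSigned cfg sent n e) : CommitSigned cfg sent' n e :=
  ⟨h hc.1, fun s hs hne => h (hc.2 s hs hne)⟩

/-- The primary contributes its `prepare`, a follower its `commit`: no active replica is missing
from the certificate, in particular not the accused. -/
theorem CommitSigned.ordered {sent : Set (P × Payload P Req Dg)} {n : ℕ} {e : Entry Req}
    (hc : CommitSigned cfg sent n e) {s : P} (hs : s ∈ cfg.sg e.view) :
    Ordered sent s (cfg.digReq e.req) n e.view := by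
  by_cases h : s = cfg.ps e.view
  · exact Or.inl (h ▸ hc.1)
  · exact Or.inr (hc.2 s hs h)

theorem CommitCert.signed {σ : State P Req Dg} {n : ℕ} {e : Entry Req}
    (h : CommitCert cfg σ n e) : CommitSigned cfg σ.sent n e :=
  ⟨h.1.1, h.2⟩

variable (cfg)

/-- `m` is a `view-change` message to view `v`, signed by its sender, and the commit log entries
in it are signed. -/
def SignedVC (sent : Set (P × Payload P Req Dg)) (v : ℕ) (m : VCMsg P Req Dg) : Prop :=
  m.view = v ∧ (m.sender, Payload.viewChange m) ∈ sent ∧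
    ∀ n e, m.commitLog.get n = some e → CommitSigned cfg sent n e

/-- `L` has an entry at `n`, of view at least `v`, and with digest `d` if its view is `v`. -/
def Retains (L : Log (Entry Req)) (d : Dg) (n v : ℕ) : Prop :=
  ∃ e, L.get n = some e ∧ v ≤ e.view ∧ (v = e.view → cfg.digReq e.req = d)

/-- The `view-change` message `m` of replica `j`, now in view `i`, retains all that `j` has ordered
in earlier views, and its prepare log is consistent with the set in `S` that was confirmed in the
view in which this log was generated. -/
structure FaithfulVC (sent : Set (P × Payload P Req Dg)) (j : P) (i : ℕ)
    (S : ℕ → Finset (VCMsg P Req Dg)) (m : VCMsg P Req Dg) : Prop where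
  view_le : m.view ≤ i
  retains : ∀ d n v, Ordered sent j d n v → v < m.view → Retains cfg m.prepareLog d n v
  -- Strictness matters: the set of a view already left is frozen, so `consistent` stays true later.
  proof_lt : ∀ fp, m.finalProof = some fp → fp.view < m.view
  proof_mem : ∀ fp, m.finalProof = some fp → j ∈ cfg.sg fp.view
  consistent : ∀ fp, m.finalProof = some fp →
    ∀ n, Consistent (S fp.view) n (m.prepareLog.get n)

/-- What the local state `l` of a benign replica `j` satisfies when the messages `sent` were sent. -/
structure LocalInv (sent : Set (P × Payload P Req Dg)) (j : P) (l : LState P Req Dg) : Prop where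
  pre_phase : (l.phase = .normal ∧ l.pre = l.view) ∨ (l.phase ≠ .normal ∧ l.pre < l.view)
  prepare_range : ∀ n e, l.prepareLog.get n = some e → n ≤ l.sn
  -- The view here is `l.pre`. It agrees with `l.view` in the normal phase, the only one in which
  -- entries are committed from the prepare log.
  prepare_signed : ∀ n e, l.prepareLog.get n = some e →
    (cfg.ps l.pre, Payload.prepare (cfg.digReq e.req) n l.pre) ∈ sent
  commit_signed : ∀ n e, l.commitLog.get n = some e → CommitSigned cfg sent n e
  vcSet_signed : ∀ v, ∀ m ∈ l.vcSet v, SignedVC cfg sent v m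
  -- Outside the normal phase the prepare log does not change, so the replica's own message still
  -- holds the current one.
  vcSet_own : l.phase ≠ .normal →
    ∃ m ∈ l.vcSet l.view, m.sender = j ∧ m.prepareLog = l.prepareLog
  sel_highest : l.phase = .awaitingNewView → ∀ n,
    IsHighest (l.vcSet l.view) VCMsg.commitLog n (l.selCommit.get n) ∧
      IsHighest (l.vcSet l.view) VCMsg.prepareLog n (l.selPrepare.get n)
  ordered_le : ∀ d n v, Ordered sent j d n v → v ≤ l.pre
  ordered_pos : ∀ d n v, Ordered sent j d n v → 1 ≤ n
  ordered_retained : ∀ d n v, Ordered sent j d n v → Retains cfg l.prepareLog d n v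
  sent_vc : ∀ m, (j, Payload.viewChange m) ∈ sent → FaithfulVC cfg sent j l.view l.vcSet m
  confirm_le : ∀ v d, (j, Payload.vcConfirm v d) ∈ sent → v ≤ l.view
  confirm_phase : ∀ v d, (j, Payload.vcConfirm v d) ∈ sent → v = l.view →
    l.phase = .confirming ∨ l.phase = .awaitingNewView ∨ l.phase = .normal
  confirm_digest : ∀ v d, (j, Payload.vcConfirm v d) ∈ sent → d = cfg.digVC (l.vcSet v)
  proof_active : ∀ v d, l.finalProof v = some d → j ∈ cfg.sg v
  consistent : ∀ n, Consistent (l.vcSet l.pre) n (l.prepareLog.get n)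
  -- Keeps the next index `l.sn + 1` outside the range in which `consistent` demands anything.
  covered_le : ∀ m ∈ l.vcSet l.pre, ∀ n,
    m.commitLog.get n ≠ none ∨ m.prepareLog.get n ≠ none → n ≤ l.sn

variable {cfg}

theorem LocalInv.init (j : P) : LocalInv cfg ∅ j (LState.init P Req Dg) := by
  constructor <;> simp [LState.init, Log.empty, Ordered, Consistent]

/-- The messages that `LocalInv` constrains when they are sent by the replica itself. -/
def Payload.IsStateful : Payload P Req Dg → Prop
  | .prepare _ _ _ | .commit _ _ _ | .viewChange _ | .vcConfirm _ _ => True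
  | _ => False

theorem SignedVC.mono {sent sent' : Set (P × Payload P Req Dg)} (hsub : sent ⊆ sent') {v : ℕ}
    {m : VCMsg P Req Dg} (h : SignedVC cfg sent v m) : SignedVC cfg sent' v m :=
  ⟨h.1, hsub h.2.1, fun n e he => (h.2.2 n e he).mono hsub⟩

theorem ValidVC.signed {σ : State P Req Dg} {m : VCMsg P Req Dg} (h : ValidVC cfg σ m) :
    SignedVC cfg σ.sent m.view m :=
  ⟨rfl, h.1, fun n e he => (h.2.1 n e he).2.signed⟩

theorem Retains.self {L : Log (Entry Req)} {n : ℕ} {e : Entry Req} (h : L.get n = some e) :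
    Retains cfg L (cfg.digReq e.req) n e.view :=
  ⟨e, h, le_rfl, fun _ => rfl⟩

/-- All that is claimed of `m` concerns views below `m.view ≤ i`. What is signed in view `i` or
later, or collected for it, cannot interfere. -/
theorem FaithfulVC.mono {sent sent' : Set (P × Payload P Req Dg)} {j : P} {i i' : ℕ}
    {S S' : ℕ → Finset (VCMsg P Req Dg)} {m : VCMsg P Req Dg} (h : FaithfulVC cfg sent j i S m)
    (hord : ∀ d n v, Ordered sent' j d n v → v < i → Ordered sent j d n v)
    (hview : i ≤ i') (hset : ∀ v < i, S' v = S v) : FaithfulVC cfg sent' j i' S' m where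
  view_le := h.view_le.trans hview
  retains d n v ho hv := h.retains d n v (hord d n v ho (hv.trans_le h.view_le)) hv
  proof_lt := h.proof_lt
  proof_mem := h.proof_mem
  consistent fp hfp := by
    rw [hset _ ((h.proof_lt fp hfp).trans_le h.view_le)]
    exact h.consistent fp hfp

/-- `LocalInv` survives new messages, unless they are stateful messages of the replica itself. -/
theorem LocalInv.mono {sent sent' : Set (P × Payload P Req Dg)} {j : P} {l : LState P Req Dg}
    (h : LocalInv cfg sent j l) (hsub : sent ⊆ sent')
    (hj : ∀ p : Payload P Req Dg, (j, p) ∈ sent' → p.IsStateful → (j, p) ∈ sent) :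
    LocalInv cfg sent' j l := by
  have hord : ∀ {d n v}, Ordered sent' j d n v → Ordered sent j d n v :=
    fun h => h.imp (hj _ · trivial) (hj _ · trivial)
  exact { h with
    prepare_signed := fun n e he => hsub (h.prepare_signed n e he)
    commit_signed := fun n e he => (h.commit_signed n e he).mono hsub
    vcSet_signed := fun v m hm => (h.vcSet_signed v m hm).mono hsub
    ordered_le := fun d n v ho => h.ordered_le d n v (hord ho)
    ordered_pos := fun d n v ho => h.ordered_pos d n v (hord ho)
    ordered_retained := fun d n v ho => h.ordered_retained d n v (hord ho)
    sent_vc := fun m hm =>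
      (h.sent_vc m (hj _ hm trivial)).mono (fun _ _ _ ho _ => hord ho) le_rfl fun _ _ => rfl
    confirm_le := fun v d hc => h.confirm_le v d (hj _ hc trivial)
    confirm_phase := fun v d hc => h.confirm_phase v d (hj _ hc trivial)
    confirm_digest := fun v d hc => h.confirm_digest v d (hj _ hc trivial) }

/-! ### Preservation of the invariant under the kinds of local change -/

section Handlers

variable {sent sent' : Set (P × Payload P Req Dg)} {j : P} {l : LState P Req Dg}

theorem LocalInv.pre_le (h : LocalInv cfg sent j l) : l.pre ≤ l.view := by
  rcases h.pre_phase with h | h <;> omega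

theorem LocalInv.pre_lt (h : LocalInv cfg sent j l) (hph : l.phase ≠ .normal) :
    l.pre < l.view := by
  rcases h.pre_phase with h' | h'
  · exact absurd h'.1 hph
  · exact h'.2

theorem LocalInv.pre_eq (h : LocalInv cfg sent j l) (hph : l.phase = .normal) :
    l.pre = l.view := by
  rcases h.pre_phase with h' | h'
  · exact h'.2
  · exact absurd hph h'.1

/-- Before `vc-confirm` was sent, the set collected for the current view may change. -/
theorem LocalInv.update_vcSet (h : LocalInv cfg sent j l)
    (hph : l.phase ≠ .confirming ∧ l.phase ≠ .awaitingNewView ∧ l.phase ≠ .normal) {φ : Phase}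
    (hφ : φ ≠ .awaitingNewView ∧ φ ≠ .normal) {V : Finset (VCMsg P Req Dg)}
    (hV : ∀ m ∈ V, SignedVC cfg sent l.view m)
    (hown : ∃ m ∈ V, m.sender = j ∧ m.prepareLog = l.prepareLog)
    (S : ℕ → P → Finset (VCMsg P Req Dg)) (F : Set P) :
    LocalInv cfg sent j { l with
      phase := φ, vcSet := Function.update l.vcSet l.view V, finalSet := S, fset := F } := by
  have hlt := h.pre_lt hph.2.2
  have hpre : Function.update l.vcSet l.view V l.pre = l.vcSet l.pre :=
    Function.update_of_ne hlt.ne _ _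
  -- A `vc-confirm` for the current view would put the replica in one of the excluded phases, so no
  -- digest of the overwritten set has been signed.
  have hne : ∀ v d, (j, Payload.vcConfirm v d) ∈ sent → v ≠ l.view := fun v d hc hv => by
    rcases h.confirm_phase v d hc hv with h' | h' | h'
    exacts [hph.1 h', hph.2.1 h', hph.2.2 h']
  exact { h with
    pre_phase := Or.inr ⟨hφ.2, hlt⟩
    vcSet_signed := fun v m hm => by
      rcases eq_or_ne v l.view with rfl | hv
      · exact hV m (by simpa using hm)
      · exact h.vcSet_signed v m (by simpa [hv] using hm)
    vcSet_own := fun _ => by simpa using hown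
    sel_highest := fun hp => absurd hp hφ.1
    sent_vc := fun m hm => (h.sent_vc m hm).mono (fun _ _ _ ho _ => ho) le_rfl
      fun v hv => Function.update_of_ne hv.ne _ _
    confirm_phase := fun v d hc hv => absurd hv (hne v d hc)
    confirm_digest := fun v d hc => by
      simpa [hne v d hc] using h.confirm_digest v d hc
    consistent := by simpa only [hpre] using h.consistent
    covered_le := by simpa only [hpre] using h.covered_le }

/-- To be applied once the reduced set is already stored, so that the signed digest is that of the
stored set. -/
theorem LocalInv.sendConfirm (h : LocalInv cfg sent j l) (hph : l.phase = .confirming)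
    (hsub : sent ⊆ sent') (hj : ∀ p : Payload P Req Dg, (j, p) ∈ sent' → p.IsStateful →
      (j, p) ∈ sent ∨ p = .vcConfirm l.view (cfg.digVC (l.vcSet l.view))) :
    LocalInv cfg sent' j l := by
  have hord : ∀ {d n v}, Ordered sent' j d n v → Ordered sent j d n v :=
    fun h => h.imp (fun h => by simpa using hj _ h trivial) (fun h => by simpa using hj _ h trivial)
  have hconf : ∀ {v d}, (j, Payload.vcConfirm v d) ∈ sent' → (j, Payload.vcConfirm v d) ∈ sent ∨
      v = l.view ∧ d = cfg.digVC (l.vcSet l.view) :=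
    fun h => by simpa using hj _ h trivial
  exact { h with
    prepare_signed := fun n e he => hsub (h.prepare_signed n e he)
    commit_signed := fun n e he => (h.commit_signed n e he).mono hsub
    vcSet_signed := fun v m hm => (h.vcSet_signed v m hm).mono hsub
    ordered_le := fun d n v ho => h.ordered_le d n v (hord ho)
    ordered_pos := fun d n v ho => h.ordered_pos d n v (hord ho)
    ordered_retained := fun d n v ho => h.ordered_retained d n v (hord ho)
    sent_vc := fun m hm => (h.sent_vc m (by simpa using hj _ hm trivial)).mono
      (fun _ _ _ ho _ => hord ho) le_rfl fun _ _ => rfl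
    confirm_le := fun v d hc => by
      rcases hconf hc with hc | ⟨rfl, -⟩
      exacts [h.confirm_le v d hc, le_rfl]
    confirm_phase := fun _ _ _ _ => Or.inl hph
    confirm_digest := fun v d hc => by
      rcases hconf hc with hc | ⟨rfl, rfl⟩
      exacts [h.confirm_digest v d hc, rfl] }

/-- The message copies the prepare log, so it inherits retention. Its final proof, if there is one,
is of view `l.pre`, with whose set this log is consistent. -/
theorem LocalInv.enterView (h : LocalInv cfg sent j l) (hsub : sent ⊆ sent')
    (hvc : (j, Payload.viewChange (vcMsg j l)) ∈ sent')
    (hj : ∀ p : Payload P Req Dg, (j, p) ∈ sent' → p.IsStateful →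
      (j, p) ∈ sent ∨ p = .viewChange (vcMsg j l)) :
    LocalInv cfg sent' j { l with
      view := l.view + 1
      phase := .collecting
      vcSet := Function.update l.vcSet (l.view + 1) {vcMsg j l} } := by
  have hpre_le := h.pre_le
  have hset : ∀ v ≤ l.view, Function.update l.vcSet (l.view + 1) {vcMsg j l} v = l.vcSet v :=
    fun v hv => Function.update_of_ne (by omega) _ _
  have hord : ∀ {d n v}, Ordered sent' j d n v → Ordered sent j d n v :=
    fun h => h.imp (fun h => by simpa using hj _ h trivial) (fun h => by simpa using hj _ h trivial)
  have hconf : ∀ {v d}, (j, Payload.vcConfirm v d) ∈ sent' → (j, Payload.vcConfirm v d) ∈ sent :=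
    fun h => by simpa using hj _ h trivial
  exact { h with
    pre_phase := Or.inr ⟨nofun, Nat.lt_succ_of_le hpre_le⟩
    prepare_signed := fun n e he => hsub (h.prepare_signed n e he)
    commit_signed := fun n e he => (h.commit_signed n e he).mono hsub
    vcSet_signed := fun v m hm => by
      rcases eq_or_ne v (l.view + 1) with rfl | hv
      · obtain rfl : m = vcMsg j l := by simpa using hm
        exact ⟨rfl, hvc, fun n e he => (h.commit_signed n e he).mono hsub⟩
      · exact (h.vcSet_signed v m (by simpa [hv] using hm)).mono hsub
    vcSet_own := fun _ => ⟨vcMsg j l, by simp, rfl, rfl⟩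
    sel_highest := nofun
    ordered_le := fun d n v ho => h.ordered_le d n v (hord ho)
    ordered_pos := fun d n v ho => h.ordered_pos d n v (hord ho)
    ordered_retained := fun d n v ho => h.ordered_retained d n v (hord ho)
    sent_vc := fun m hm => by
      rcases hj _ hm trivial with hm | hm
      · exact (h.sent_vc m hm).mono (fun _ _ _ ho _ => hord ho) (Nat.le_succ _)
          fun v hv => hset v hv.le
      · obtain rfl : m = vcMsg j l := by simpa using hm
        have hfp : ∀ fp, (vcMsg j l).finalProof = some fp →
            fp.view = l.pre ∧ j ∈ cfg.sg l.pre := by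
          intro fp hfp
          obtain ⟨d, hd, rfl⟩ := Option.map_eq_some_iff.1 hfp
          exact ⟨rfl, h.proof_active _ _ hd⟩
        exact
          { view_le := le_rfl
            retains := fun d n v ho _ => h.ordered_retained d n v (hord ho)
            proof_lt := fun fp hp => by
              rw [(hfp fp hp).1]
              exact Nat.lt_succ_of_le hpre_le
            proof_mem := fun fp hp => by
              rw [(hfp fp hp).1]
              exact (hfp fp hp).2
            consistent := fun fp hp => by
              intro n
              have := h.consistent n
              rw [← hset _ hpre_le] at this
              rw [(hfp fp hp).1]
              exact this }
    confirm_le := fun v d hc => (h.confirm_le v d (hconf hc)).trans (Nat.le_succ _)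
    -- Vacuous: nothing has been confirmed yet for view `l.view + 1`.
    confirm_phase := fun v d hc hv => by
      have : v ≤ l.view := h.confirm_le v d (hconf hc)
      have hv : v = l.view + 1 := hv
      omega
    confirm_digest := fun v d hc => by
      have := h.confirm_digest v d (hconf hc)
      rwa [← hset v (h.confirm_le v d (hconf hc))] at this
    consistent := by simpa only [hset _ hpre_le] using h.consistent
    covered_le := by simpa only [hset _ hpre_le] using h.covered_le }

/-- A request is ordered in the common case. -/
theorem LocalInv.append (h : LocalInv cfg sent j l) (hph : l.phase = .normal) (r : Req)
    {C : Log (Entry Req)} (hsub : sent ⊆ sent')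
    (hprep : (cfg.ps l.view, Payload.prepare (cfg.digReq (some r)) (l.sn + 1) l.view) ∈ sent')
    (hC : ∀ n e, C.get n = some e → CommitSigned cfg sent' n e)
    (hj : ∀ p : Payload P Req Dg, (j, p) ∈ sent' → p.IsStateful → (j, p) ∈ sent ∨
      p = .prepare (cfg.digReq (some r)) (l.sn + 1) l.view ∨
      p = .commit (cfg.digReq (some r)) (l.sn + 1) l.view) :
    LocalInv cfg sent' j { l with
      sn := l.sn + 1
      prepareLog := l.prepareLog.set (l.sn + 1) ⟨some r, l.view⟩
      commitLog := C } := by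
  have hpre := h.pre_eq hph
  have hget : ∀ n, (l.prepareLog.set (l.sn + 1) ⟨some r, l.view⟩).get n =
      if n = l.sn + 1 then some ⟨some r, l.view⟩ else l.prepareLog.get n :=
    fun n => Function.update_apply _ _ _ _
  have hord : ∀ {d n v}, Ordered sent' j d n v → Ordered sent j d n v ∨
      d = cfg.digReq (some r) ∧ n = l.sn + 1 ∧ v = l.view := by
    rintro d n v (ho | ho)
    · rcases hj _ ho trivial with ho | ho
      · exact Or.inl (Or.inl ho)
      · exact Or.inr (by simpa using ho)
    · rcases hj _ ho trivial with ho | ho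
      · exact Or.inl (Or.inr ho)
      · exact Or.inr (by simpa using ho)
  have hvc : ∀ {m}, (j, Payload.viewChange m) ∈ sent' → (j, Payload.viewChange m) ∈ sent :=
    fun h => by simpa using hj _ h trivial
  have hconf : ∀ {v d}, (j, Payload.vcConfirm v d) ∈ sent' → (j, Payload.vcConfirm v d) ∈ sent :=
    fun h => by simpa using hj _ h trivial
  have hret : ∀ {d n v}, Retains cfg l.prepareLog d n v →
      Retains cfg (l.prepareLog.set (l.sn + 1) ⟨some r, l.view⟩) d n v := by
    rintro d n v ⟨e, he, hve⟩
    -- Index `l.sn + 1` was free, so no earlier entry is overwritten.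
    have := h.prepare_range n e he
    exact ⟨e, by rw [hget, if_neg (by omega), he], hve⟩
  exact { h with
    prepare_range := fun n e he => by
      simp only [hget] at he
      split_ifs at he with hn
      · exact hn.le
      · exact (h.prepare_range n e he).trans (Nat.le_succ _)
    prepare_signed := fun n e he => by
      simp only [hget] at he
      split_ifs at he with hn
      · cases he; simpa only [hn, hpre] using hprep
      · exact hsub (h.prepare_signed n e he)
    commit_signed := hC
    vcSet_signed := fun v m hm => (h.vcSet_signed v m hm).mono hsub
    vcSet_own := fun hp => absurd hph hp
    ordered_le := fun d n v ho => by
      rcases hord ho with ho | ⟨-, -, rfl⟩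
      exacts [h.ordered_le d n v ho, hpre.ge]
    ordered_pos := fun d n v ho => by
      rcases hord ho with ho | ⟨-, rfl, -⟩
      exacts [h.ordered_pos d n v ho, Nat.succ_pos _]
    ordered_retained := fun d n v ho => by
      rcases hord ho with ho | ⟨rfl, rfl, rfl⟩
      · exact hret (h.ordered_retained d n v ho)
      · exact Retains.self (e := ⟨some r, l.view⟩) (by simp [hget])
    sent_vc := fun m hm => (h.sent_vc m (hvc hm)).mono
      (fun d n v ho hv => (hord ho).resolve_right fun h' => hv.ne h'.2.2) le_rfl fun _ _ => rfl
    confirm_le := fun v d hc => h.confirm_le v d (hconf hc)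
    confirm_phase := fun v d hc => h.confirm_phase v d (hconf hc)
    confirm_digest := fun v d hc => h.confirm_digest v d (hconf hc)
    consistent := fun n hn => by
      obtain ⟨h1, k, hk, m, hm, hmk⟩ := hn
      -- Here `n ≤ k ≤ l.sn`, so the appended cell is not the one at `n`.
      have := h.covered_le m hm k hmk
      simp only [hget]
      rw [if_neg (by omega)]
      exact h.consistent n ⟨h1, k, hk, m, hm, hmk⟩
    covered_le := fun m hm n hn => (h.covered_le m hm n hn).trans (Nat.le_succ _) }

/-- The prepare log of a new view replaces the old one. -/
theorem LocalInv.install (h : LocalInv cfg sent j l)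
    (hph : l.phase = .confirming ∨ l.phase = .awaitingNewView) {C L C' : Log (Entry Req)}
    {proof : ℕ → Option Dg} {selC selL : Log (Entry Req)} (hact : j ∈ cfg.sg l.view)
    (hC : ∀ n, IsHighest (l.vcSet l.view) VCMsg.commitLog n (C.get n))
    (hL : ∀ n, IsHighest (l.vcSet l.view) VCMsg.prepareLog n (L.get n))
    (hproof : ∀ v d, proof v = some d → l.finalProof v = some d ∨ v = l.view)
    (hsub : sent ⊆ sent')
    (hprep : ∀ n e, (newLog l.view C L).get n = some e →
      (cfg.ps l.view, Payload.prepare (cfg.digReq e.req) n l.view) ∈ sent')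
    (hC' : ∀ n e, C'.get n = some e → CommitSigned cfg sent' n e)
    (hj : ∀ p : Payload P Req Dg, (j, p) ∈ sent' → p.IsStateful → (j, p) ∈ sent ∨
      ∃ n e, (newLog l.view C L).get n = some e ∧
        (p = .prepare (cfg.digReq e.req) n l.view ∨ p = .commit (cfg.digReq e.req) n l.view)) :
    LocalInv cfg sent' j { l with
      phase := .normal
      finalProof := proof
      selCommit := selC
      selPrepare := selL
      prepareLog := newLog l.view C L
      commitLog := C'
      sn := (newLog l.view C L).last
      pre := l.view } := by
  have hnn : l.phase ≠ .normal := by rcases hph with h | h <;> simp [h]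
  have hlt := h.pre_lt hnn
  have hview : ∀ {n e}, (newLog l.view C L).get n = some e → e.view = l.view := fun he => by
    rw [(newLog_get_eq_some.1 he).2]
  have hord : ∀ {d n v}, Ordered sent' j d n v → Ordered sent j d n v ∨
      ∃ e, (newLog l.view C L).get n = some e ∧ d = cfg.digReq e.req ∧ v = l.view := by
    rintro d n v (ho | ho)
    · rcases hj _ ho trivial with ho | ⟨n', e, he, ho⟩
      · exact Or.inl (Or.inl ho)
      · obtain ⟨rfl, rfl, rfl⟩ : d = _ ∧ n = n' ∧ v = _ := by simpa using ho
        exact Or.inr ⟨e, he, rfl, rfl⟩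
    · rcases hj _ ho trivial with ho | ⟨n', e, he, ho⟩
      · exact Or.inl (Or.inr ho)
      · obtain ⟨rfl, rfl, rfl⟩ : d = _ ∧ n = n' ∧ v = _ := by simpa using ho
        exact Or.inr ⟨e, he, rfl, rfl⟩
  have hvc : ∀ {m}, (j, Payload.viewChange m) ∈ sent' → (j, Payload.viewChange m) ∈ sent :=
    fun h => by simpa using hj _ h trivial
  have hconf : ∀ {v d}, (j, Payload.vcConfirm v d) ∈ sent' → (j, Payload.vcConfirm v d) ∈ sent :=
    fun h => by simpa using hj _ h trivial
  exact { h with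
    pre_phase := Or.inl ⟨rfl, rfl⟩
    prepare_range := fun n e he => Log.le_last (by rw [he]; nofun)
    prepare_signed := hprep
    commit_signed := hC'
    vcSet_signed := fun v m hm => (h.vcSet_signed v m hm).mono hsub
    vcSet_own := fun hp => absurd rfl hp
    sel_highest := nofun
    ordered_le := fun d n v ho => by
      rcases hord ho with ho | ⟨e, he, -, rfl⟩
      exacts [(h.ordered_le d n v ho).trans hlt.le, le_rfl]
    ordered_pos := fun d n v ho => by
      rcases hord ho with ho | ⟨e, he, -, rfl⟩
      exacts [h.ordered_pos d n v ho, (newLog_get_eq_some.1 he).1.1]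
    ordered_retained := fun d n v ho => by
      rcases hord ho with ho | ⟨e, he, rfl, rfl⟩
      -- The replica's own message witnesses that `n` is covered. The new entry there has a view
      -- strictly above `v`, so its request is unconstrained.
      · obtain ⟨m, hm, -, hml⟩ := h.vcSet_own hnn
        obtain ⟨e, he, -⟩ := h.ordered_retained d n v ho
        have hle : n ≤ max C.last L.last :=
          le_last_of_covered hC hL hm (Or.inr (by rw [hml, he]; nofun))
        have hv := (h.ordered_le d n v ho).trans_lt hlt
        exact ⟨_, newLog_get_eq_some.2 ⟨⟨h.ordered_pos d n v ho, hle⟩, rfl⟩, hv.le,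
          fun h' => absurd h' hv.ne⟩
      · have := Retains.self (cfg := cfg) he
        rwa [hview he] at this
    sent_vc := fun m hm => (h.sent_vc m (hvc hm)).mono
      (fun d n v ho hv => (hord ho).resolve_right fun ⟨_, _, _, h'⟩ => hv.ne h') le_rfl
      fun _ _ => rfl
    confirm_le := fun v d hc => h.confirm_le v d (hconf hc)
    confirm_phase := fun _ _ _ _ => Or.inr (Or.inr rfl)
    confirm_digest := fun v d hc => h.confirm_digest v d (hconf hc)
    proof_active := fun v d hp => by
      rcases hproof v d hp with hp | rfl
      exacts [h.proof_active v d hp, hact]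
    consistent := fun n => consistent_newLog hC hL l.view n
    covered_le := fun m hm n hn => Log.le_last_tabulate (le_last_of_covered hC hL hm hn) }

/-- If `t = 1`, a group has two members, so a single follower's `commit` together with the primary's
`prepare` is a full certificate. -/
theorem commitAtOnce.signed {i : ℕ} {C L C' : Log (Entry Req)} (h : commitAtOnce cfg j i C L C')
    (hj : j ∈ cfg.sg i) (hC : ∀ n e, C.get n = some e → CommitSigned cfg sent n e)
    (hL : ∀ n e, L.get n = some e → e.view = i ∧
      (cfg.ps i, Payload.prepare (cfg.digReq e.req) n i) ∈ sent ∧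
      (j, Payload.commit (cfg.digReq e.req) n i) ∈ sent) :
    ∀ n e, C'.get n = some e → CommitSigned cfg sent n e := by
  rcases h with ⟨⟨ht, hne, rfl⟩⟩ | ⟨-, rfl⟩
  · intro n e he
    rcases Option.or_eq_some_iff.1 he with he | ⟨-, he⟩
    · obtain ⟨rfl, hp, hc⟩ := hL n e he
      refine ⟨hp, fun s hs hs' => ?_⟩
      obtain rfl : s = j := by
        by_contra hsj
        have hcard : 2 < (cfg.sg e.view).card :=
          Finset.two_lt_card.2 ⟨s, hs, j, hj, _, cfg.ps_mem _, hsj, hs', hne⟩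
        rw [cfg.card_sg, ht] at hcard
        omega
      exact hc
    · exact hC n e he
  · exact hC

end Handlers

/-! ### Preservation of the invariant by the event handlers -/

omit [Fintype P] in
theorem State.mem_next_sent {σ : State P Req Dg} {j i : P} {l : LState P Req Dg}
    {out : Set (Payload P Req Dg)} {p : Payload P Req Dg} :
    (i, p) ∈ (σ.next j l out).sent ↔ (i, p) ∈ σ.sent ∨ i = j ∧ p ∈ out := Iff.rfl

omit [Fintype P] in
theorem State.sent_subset_next {σ : State P Req Dg} {j : P} {l : LState P Req Dg}
    {out : Set (Payload P Req Dg)} : σ.sent ⊆ (σ.next j l out).sent :=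
  Set.subset_union_left

theorem LocalInv.next_of_quiet {σ : State P Req Dg} {j : P} {l l' : LState P Req Dg}
    {out : Set (Payload P Req Dg)} (h : LocalInv cfg σ.sent j l)
    (hout : ∀ p ∈ out, ¬ p.IsStateful) : LocalInv cfg (σ.next j l' out).sent j l :=
  h.mono State.sent_subset_next fun p hp hs =>
    (State.mem_next_sent.1 hp).resolve_right fun h' => hout p h'.2 hs

/-- The sets merged from valid `vc-final` messages hold signed `view-change` messages. -/
theorem signed_of_mem_unionFinal {σ : State P Req Dg} {i : ℕ}
    {S : P → Finset (VCMsg P Req Dg)}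
    (hS : ∀ s ∈ cfg.sg i, (s, .vcFinal i (S s)) ∈ σ.sent ∧ ∀ m ∈ S s, m.view = i ∧ ValidVC cfg σ m)
    {m : VCMsg P Req Dg} (hm : m ∈ unionFinal cfg i S) : SignedVC cfg σ.sent i m := by
  classical
  rw [unionFinal, Finset.mem_biUnion] at hm
  obtain ⟨s, hs, hm⟩ := hm
  obtain ⟨rfl, hm⟩ := (hS s hs).2 m hm
  exact hm.signed

omit [Fintype P] in
theorem mem_removeFaulty {V : Finset (VCMsg P Req Dg)} {F : Set P} {m : VCMsg P Req Dg} :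
    m ∈ removeFaulty V F ↔ m ∈ V ∧ m.sender ∉ F := by
  classical
  rw [removeFaulty, Finset.mem_filter]

-- The hypothesis `hf` serves the `confirm` handler: a replica that had detected itself would drop
-- its own message and could lose entries.
open scoped Classical in
theorem LocalInv.handler {σ : State P Req Dg} {j : P} {l : LState P Req Dg}
    {out : Set (Payload P Req Dg)} (h : LocalInv cfg σ.sent j (σ.loc j))
    (hf : j ∉ (σ.loc j).fset) (hh : Handler cfg σ j l out) :
    LocalInv cfg (σ.next j l out).sent j l := by
  have hcs : ∀ n e, (σ.loc j).commitLog.get n = some e →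
      CommitSigned cfg (σ.next j l out).sent n e :=
    fun n e he => (h.commit_signed n e he).mono State.sent_subset_next
  cases hh with
  | order r hj hph hr =>
    refine h.append hph r State.sent_subset_next ?_ hcs ?_
    · exact Or.inr ⟨hj.symm, rfl⟩
    · exact fun p hp _ => (State.mem_next_sent.1 hp).imp_right fun h' => Or.inl h'.2
  | follow r C hj hne hph hr hp hC =>
    refine h.append hph r State.sent_subset_next (Or.inl hp) (hC.signed hj hcs ?_) ?_
    · intro n e he
      obtain ⟨rfl, rfl⟩ : n = (σ.loc j).sn + 1 ∧ e = ⟨some r, (σ.loc j).view⟩ := by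
        by_cases hn : n = (σ.loc j).sn + 1
        · subst hn; simpa [Log.set, eq_comm] using he
        · simp [Log.set, Log.empty, hn] at he
      exact ⟨rfl, Or.inl hp, Or.inr ⟨rfl, rfl⟩⟩
    · exact fun p hp _ => (State.mem_next_sent.1 hp).imp_right fun h' => Or.inr h'.2
  | commit n e hj hph he hc =>
    refine LocalInv.next_of_quiet { h with commit_signed := fun n' e' he' => ?_ } (by simp)
    by_cases hn : n' = n
    · subst hn
      obtain rfl : ⟨e.req, (σ.loc j).view⟩ = e' := by simpa [Log.set] using he'
      have := h.prepare_signed _ _ he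
      rw [h.pre_eq hph] at this
      exact ⟨this, hc⟩
    · exact h.commit_signed n' e' (by simpa [Log.set, hn] using he')
  | suspect hj => exact h.next_of_quiet (by simp [Payload.IsStateful])
  | enterView k hk hs =>
    exact h.enterView State.sent_subset_next (Or.inr ⟨rfl, rfl⟩)
      fun p hp _ => (State.mem_next_sent.1 hp).imp_right fun h' => h'.2
  | recvViewChange m hj hph hv hm =>
    have hne : (σ.loc j).phase ≠ .normal := by simp [hph]
    refine LocalInv.next_of_quiet ?_ (by simp)
    have := h.update_vcSet (by simp [hph]) (φ := .collecting) (by simp)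
      (V := insert m ((σ.loc j).vcSet (σ.loc j).view)) ?_ ?_ (σ.loc j).finalSet (σ.loc j).fset
    · rwa [← hph] at this
    · intro m' hm'
      rcases Finset.mem_insert.1 hm' with rfl | hm'
      · exact hv ▸ hm.signed
      · exact h.vcSet_signed _ _ hm'
    · obtain ⟨m', hm', h'⟩ := h.vcSet_own hne
      exact ⟨m', Finset.mem_insert_of_mem hm', h'⟩
  | sendFinal hj hph hn =>
    have hne : (σ.loc j).phase ≠ .normal := by simp [hph]
    refine LocalInv.next_of_quiet ?_ (by simp [Payload.IsStateful])
    simpa using h.update_vcSet (by simp [hph]) (φ := .finalizing) (by simp)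
      (h.vcSet_signed _) (h.vcSet_own hne) (σ.loc j).finalSet (σ.loc j).fset
  | detect S V hj hph hS hV =>
    have hne : (σ.loc j).phase ≠ .normal := by simp [hph]
    refine LocalInv.next_of_quiet (h.update_vcSet (by simp [hph]) (by simp) ?_ ?_ _ _) ?_
    · intro m hm
      rw [hV, Finset.mem_union] at hm
      rcases hm with hm | hm
      · exact h.vcSet_signed _ _ hm
      · exact signed_of_mem_unionFinal hS hm
    · obtain ⟨m', hm', h'⟩ := h.vcSet_own hne
      exact ⟨m', hV ▸ Finset.mem_union_left _ hm', h'⟩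
    · rintro p ⟨n, m, -, m', -, ⟨-, rfl⟩ | ⟨-, rfl⟩ | ⟨-, rfl⟩⟩ <;> exact id
  | confirm V hj hph hV =>
    have hne : (σ.loc j).phase ≠ .normal := by simp [hph]
    refine LocalInv.sendConfirm (h.update_vcSet (by simp [hph]) (φ := .confirming) (by simp)
      (V := V) ?_ ?_ (σ.loc j).finalSet (σ.loc j).fset) rfl State.sent_subset_next ?_
    · intro m hm
      rw [hV, mem_removeFaulty] at hm
      exact h.vcSet_signed _ _ hm.1
    · obtain ⟨m, hm, hs, hl⟩ := h.vcSet_own hne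
      refine ⟨m, ?_, hs, hl⟩
      rw [hV, mem_removeFaulty]
      exact ⟨hm, hs ▸ hf⟩
    · exact fun p hp _ => (State.mem_next_sent.1 hp).imp_right fun h' => by simpa using h'.2
  | startFollower d C L hj hne hph hd hC hL =>
    have hnn : (σ.loc j).phase ≠ .normal := by simp [hph]
    refine LocalInv.next_of_quiet ?_ (by simp)
    exact { h with
      pre_phase := Or.inr ⟨nofun, h.pre_lt hnn⟩
      vcSet_own := fun _ => h.vcSet_own hnn
      sel_highest := fun _ n => ⟨hC n, hL n⟩
      confirm_phase := fun _ _ _ _ => Or.inr (Or.inl rfl)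
      proof_active := fun v d' hp => by
        by_cases hv : v = (σ.loc j).view
        · exact hv ▸ hj
        · exact h.proof_active v d' (by simpa [hv] using hp) }
  | startPrimary d C L hj hph hd hC hL =>
    have hact : j ∈ cfg.sg (σ.loc j).view := by
      convert cfg.ps_mem (σ.loc j).view
    refine h.install (Or.inl hph) hact hC hL ?_ State.sent_subset_next ?_ hcs ?_
    · intro v d' hp
      by_cases hv : v = (σ.loc j).view
      · exact Or.inr hv
      · exact Or.inl (by simpa [hv] using hp)
    · exact fun n e he => Or.inr ⟨hj.symm, Or.inr ⟨n, e, he, rfl⟩⟩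
    · rintro p (hp | ⟨-, hp | ⟨n, e, he, hp⟩⟩) hs
      · exact Or.inl hp
      · obtain rfl : p = _ := hp
        exact hs.elim
      · exact Or.inr ⟨n, e, he, Or.inl hp⟩
  | recvNewView L C hj hne hph hs hp hL hC =>
    subst hL
    have hview : ∀ {n e}, (newLog (σ.loc j).view (σ.loc j).selCommit (σ.loc j).selPrepare).get n =
        some e → e.view = (σ.loc j).view := fun he => by
      rw [(newLog_get_eq_some.1 he).2]
    have hprep : ∀ n e,
        (newLog (σ.loc j).view (σ.loc j).selCommit (σ.loc j).selPrepare).get n = some e →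
        (cfg.ps (σ.loc j).view, Payload.prepare (cfg.digReq e.req) n (σ.loc j).view) ∈ σ.sent :=
      fun n e he => hview he ▸ (hp n e he).1
    -- The selection was stored when the final proof arrived, and `sel_highest` still relates it to
    -- the confirmed set.
    refine h.install (Or.inr hph) hj (fun n => (h.sel_highest hph n).1)
      (fun n => (h.sel_highest hph n).2) (fun _ _ => Or.inl) State.sent_subset_next
      (fun n e he => Or.inl (hprep n e he)) (hC.signed hj hcs fun n e he => ?_) ?_
    · exact ⟨hview he, Or.inl (hprep n e he), Or.inr ⟨rfl, n, e, he, rfl⟩⟩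
    · rintro p (hp | ⟨-, n, e, he, hp⟩) -
      · exact Or.inl hp
      · exact Or.inr ⟨n, e, he, Or.inr hp⟩
  | recvQuery s i k n m fp d hs hm hi hk hfp hj hd hc =>
    exact h.next_of_quiet (by simp [Payload.IsStateful])
  | recvForkII s i k n m fp S hs he =>
    exact LocalInv.next_of_quiet { h with } (by simp [Payload.IsStateful])
  | recvStateLoss s i k n m m' hs he => exact h.next_of_quiet (by simp [Payload.IsStateful])
  | recvForkI s i k n m m' hs he => exact h.next_of_quiet (by simp [Payload.IsStateful])

/-! ### Soundness of the checks against a benign replica -/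

section Soundness

variable {sent : Set (P × Payload P Req Dg)} {k : P} {l : LState P Req Dg}
  {m m' : VCMsg P Req Dg} {i i' n : ℕ}

/-- The commit entry in `m'` carries a signature of `k` from a view below that of `m`. The sender of
`m'` may be anyone. -/
theorem LocalInv.retains_of_signed (h : LocalInv cfg sent k l) (hm : SignedVC cfg sent i m)
    (hk : m.sender = k) (hm' : SignedVC cfg sent i' m') {c : Entry Req}
    (hc : m'.commitLog.get n = some c) (hv : c.view < i) (hact : k ∈ cfg.sg c.view) :
    Retains cfg m.prepareLog (cfg.digReq c.req) n c.view := by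
  obtain ⟨rfl, hs, -⟩ := hm
  exact (h.sent_vc m (hk ▸ hs)).retains _ _ _ ((hm'.2.2 n c hc).ordered hact) hv

theorem LocalInv.not_stateLoss (h : LocalInv cfg sent k l) (hm : SignedVC cfg sent i m)
    (hk : m.sender = k) (hm' : SignedVC cfg sent i' m') : ¬ StateLoss cfg i n m m' := by
  rintro ⟨v, hv, hact, -, ⟨c, hc, rfl⟩, hnone⟩
  obtain ⟨e, he, -⟩ := h.retains_of_signed hm hk hm' hc hv (hk ▸ hact)
  rw [hnone] at he
  cases he

theorem LocalInv.not_forkI (h : LocalInv cfg sent k l) (hm : SignedVC cfg sent i m)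
    (hk : m.sender = k) (hm' : SignedVC cfg sent i' m') : ¬ ForkI cfg i n m m' := by
  rintro ⟨v, hv, hact, -, e, c, he, hc, rfl, hbad⟩
  obtain ⟨e', he', hle, heq⟩ := h.retains_of_signed hm hk hm' hc hv (hk ▸ hact)
  obtain rfl : e = e' := Option.some.inj (he.symm.trans he')
  rcases hbad with ⟨hev, hne⟩ | hlt
  · exact hne (cfg.digReq_injective (heq hev.symm))
  · omega

/-- `k` is active in the view of the proof, hence among the signers of the digest of `V`;
injectivity identifies `V` with the set that `k` stored. Only the view of `fp` enters. -/
theorem LocalInv.consistent_of_confirmed (h : LocalInv cfg sent k l)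
    (hm : (k, Payload.viewChange m) ∈ sent) {fp : FinalProof Dg} (hfp : m.finalProof = some fp)
    {V : Finset (VCMsg P Req Dg)}
    (hV : ∀ s ∈ cfg.sg fp.view, (s, Payload.vcConfirm fp.view (cfg.digVC V)) ∈ sent) :
    Consistent V n (m.prepareLog.get n) := by
  have hf := h.sent_vc m hm
  have := h.confirm_digest _ _ (hV k (hf.proof_mem fp hfp))
  rw [cfg.digVC_injective this]
  exact hf.consistent fp hfp n

end Soundness

variable {σ : State P Req Dg} {k : P}

theorem LocalInv.not_stateLossEvidence (h : LocalInv cfg σ.sent k (σ.loc k)) {i n : ℕ}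
    {m m' : VCMsg P Req Dg} : ¬ StateLossEvidence cfg σ i k n m m' := by
  rintro ⟨hm, hm', rfl, -, hk, hsl⟩
  exact h.not_stateLoss hm.signed hk hm'.signed hsl

theorem LocalInv.not_forkIEvidence (h : LocalInv cfg σ.sent k (σ.loc k)) {i n : ℕ}
    {m m' : VCMsg P Req Dg} : ¬ ForkIEvidence cfg σ i k n m m' := by
  rintro ⟨hm, hm', rfl, -, hk, hf⟩
  exact h.not_forkI hm.signed hk hm'.signed hf

theorem LocalInv.not_forkIIEvidence (h : LocalInv cfg σ.sent k (σ.loc k)) {i n : ℕ}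
    {m : VCMsg P Req Dg} {fp : FinalProof Dg} {S : P → Finset (VCMsg P Req Dg)} :
    ¬ ForkIIEvidence cfg σ i k n m fp S := by
  rintro ⟨hm, -, rfl, ⟨fp', hfp', hv⟩, hfp, -, F, hd, hc⟩
  refine hc (h.consistent_of_confirmed hm.1 hfp' fun s hs => ?_)
  rw [hd, hv]
  exact hfp s (hv ▸ hs)

/-! ### The global invariant along executions -/

/-- A message that announces a fault of `k`. -/
def Payload.Accuses (k : P) : Payload P Req Dg → Prop
  | .stateLoss _ k' _ _ _ | .forkI _ k' _ _ _ | .forkII _ k' _ _ _ _ => k' = k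
  | _ => False

variable (cfg) in
/-- Benign replicas satisfy their local invariant and do not accuse each other. -/
structure Inv (B : Set P) (σ : State P Req Dg) : Prop where
  loc : ∀ j ∈ B, LocalInv cfg σ.sent j (σ.loc j)
  fset : ∀ j ∈ B, ∀ k ∈ B, k ∉ (σ.loc j).fset
  not_accused : ∀ j ∈ B, ∀ k ∈ B, ∀ p : Payload P Req Dg, p.Accuses k → (j, p) ∉ σ.sent

-- New accusations arise from the checks, from the answer to a query, or by relaying verified
-- evidence. Each is refuted by the local invariant of the accused `k`; only `detect` and
-- `recvQuery` also need that of the accuser.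
open scoped Classical in
theorem Inv.handler_accurate {B : Set P} (h : Inv cfg B σ) {j : P} (hj : j ∈ B) (hk : k ∈ B)
    {l : LState P Req Dg} {out : Set (Payload P Req Dg)} (hh : Handler cfg σ j l out) :
    k ∉ l.fset ∧ ∀ p ∈ out, ¬ p.Accuses k := by
  have hf := h.fset j hj k hk
  have hl := h.loc k hk
  cases hh with
  | detect S V hact hph hS hV =>
    have hsig : ∀ m ∈ V, SignedVC cfg σ.sent (σ.loc j).view m := by
      intro m hm
      rw [hV, Finset.mem_union] at hm
      rcases hm with hm | hm
      · exact (h.loc j hj).vcSet_signed _ _ hm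
      · exact signed_of_mem_unionFinal hS hm
    refine ⟨?_, ?_⟩
    · rintro (hk' | ⟨n, m, hm, m', hm', hs, hsl | hfi⟩)
      · exact hf hk'
      · exact hl.not_stateLoss (hsig m hm) hs (hsig m' hm') hsl
      · exact hl.not_forkI (hsig m hm) hs (hsig m' hm') hfi
    · rintro p ⟨n, m, hm, m', hm', ⟨hsl, rfl⟩ | ⟨hfi, rfl⟩ | ⟨-, rfl⟩⟩ hs
      · exact hl.not_stateLoss (hsig m hm) hs (hsig m' hm') hsl
      · exact hl.not_forkI (hsig m hm) hs (hsig m' hm') hfi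
      · exact hs
  | recvQuery s i k' n m fp d hs hm hi hk' hfp hact hd hc =>
    refine ⟨hf, ?_⟩
    rintro p rfl (rfl : k' = k)
    have hcert := hm.2.2.2 fp hfp
    refine hc (hl.consistent_of_confirmed (hk' ▸ hm.1) hfp fun s' hs' => ?_)
    -- The answering replica also signed the final proof in `m`, so the digest in that proof is the
    -- digest of its own stored set.
    rw [← (h.loc j hj).confirm_digest _ _ (hcert j hact)]
    exact hcert s' hs'
  | recvForkII s i k' n m fp S hs he =>
    have hne : k' ≠ k := fun hkk => hl.not_forkIIEvidence (hkk ▸ he)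
    refine ⟨fun hmem => ?_, ?_⟩
    · rcases hmem with rfl | hmem
      exacts [hne rfl, hf hmem]
    · rintro p rfl
      exact hne
  | recvStateLoss s i k' n m m' hs he =>
    refine ⟨hf, ?_⟩
    rintro p rfl (rfl : k' = k)
    exact hl.not_stateLossEvidence he
  | recvForkI s i k' n m m' hs he =>
    refine ⟨hf, ?_⟩
    rintro p rfl (rfl : k' = k)
    exact hl.not_forkIEvidence he
  | startPrimary =>
    refine ⟨hf, ?_⟩
    rintro p (rfl | ⟨n, e, -, rfl⟩) <;> exact id
  | recvNewView =>
    refine ⟨hf, ?_⟩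
    rintro p ⟨n, e, -, rfl⟩
    exact id
  | _ => exact ⟨hf, by simp [Payload.Accuses]⟩

theorem Inv.next {B : Set P} (h : Inv cfg B σ) {j : P} {l : LState P Req Dg}
    {out : Set (Payload P Req Dg)} (hl : LocalInv cfg (σ.next j l out).sent j l)
    (hacc : ∀ k ∈ B, k ∉ l.fset ∧ ∀ p ∈ out, ¬ p.Accuses k) : Inv cfg B (σ.next j l out) where
  loc i hi := by
    by_cases hij : i = j
    · subst hij
      simpa [State.next] using hl
    · have := (h.loc i hi).mono (sent' := (σ.next j l out).sent) State.sent_subset_next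
        fun p hp _ => (State.mem_next_sent.1 hp).resolve_right fun h' => hij h'.1
      simpa [State.next, hij] using this
  fset i hi k hk := by
    by_cases hij : i = j
    · subst hij
      simpa [State.next] using (hacc k hk).1
    · simpa [State.next, hij] using h.fset i hi k hk
  not_accused i hi k hk p hp hs := by
    rcases State.mem_next_sent.1 hs with hs | ⟨-, hs⟩
    exacts [h.not_accused i hi k hk p hp hs, (hacc k hk).2 p hs hp]

theorem Inv.step {B : Set P} {σ' : State P Req Dg} (h : Inv cfg B σ) (hs : Step cfg B σ σ') :
    Inv cfg B σ' := by
  cases hs with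
  | handle j hj _ l out hh =>
    exact h.next ((h.loc j hj).handler (h.fset j hj j hj) hh)
      fun k hk => h.handler_accurate hj hk hh
  | crash j hj =>
    exact h.next (LocalInv.next_of_quiet { h.loc j hj with } (by simp))
      fun k hk => ⟨h.fset j hj k hk, by simp⟩
  | arbitrary s hs p =>
    have hmem : ∀ {j q}, j ∈ B → (j, q) ∈ insert (s, p) σ.sent → (j, q) ∈ σ.sent :=
      fun hj hq => hq.resolve_left fun h' => by
        obtain ⟨rfl, -⟩ := Prod.mk.inj h'
        exact hs hj
    exact
      { loc := fun j hj => (h.loc j hj).mono (Set.subset_insert _ _) fun q hq _ => hmem hj hq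
        fset := h.fset
        not_accused := fun j hj k hk q hq hq' => h.not_accused j hj k hk q hq (hmem hj hq') }
  -- The invariant refers to signatures of replicas only, so `issued` does not enter.
  | request r => exact { h with }

theorem Inv.of_reachable {B : Set P} (hσ : Reachable cfg B σ) : Inv cfg B σ := by
  induction hσ with
  | refl => exact ⟨fun j _ => LocalInv.init j, fun _ _ _ _ => id, fun _ _ _ _ _ _ => id⟩
  | tail _ hs ih => exact ih.step hs

end Invariant

end XPaxos

theorem theorem6 {P Req Dg : Type*} [Fintype P] (cfg : XPaxos.Config P Req Dg) (B : Set P)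
    (σ : XPaxos.State P Req Dg) (hσ : XPaxos.Reachable cfg B σ) (k : P) (hk : k ∈ B) :
    (∀ j ∈ B, k ∉ (σ.loc j).fset) ∧
    (∀ j ∈ B, ∀ i sn m m', (j, .stateLoss i k sn m m') ∉ σ.sent) ∧
    (∀ j ∈ B, ∀ i sn m m', (j, .forkI i k sn m m') ∉ σ.sent) ∧
    (∀ j ∈ B, ∀ i sn m fp S, (j, .forkII i k sn m fp S) ∉ σ.sent) ∧
    (∀ i sn m m', ¬ XPaxos.StateLossEvidence cfg σ i k sn m m') ∧
    (∀ i sn m m', ¬ XPaxos.ForkIEvidence cfg σ i k sn m m') ∧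
    (∀ i sn m fp S, ¬ XPaxos.ForkIIEvidence cfg σ i k sn m fp S) := by
  have h := XPaxos.Inv.of_reachable hσ
  have hl := h.loc k hk
  exact ⟨fun j hj => h.fset j hj k hk,
    fun j hj _ _ _ _ => h.not_accused j hj k hk _ rfl,
    fun j hj _ _ _ _ => h.not_accused j hj k hk _ rfl,
    fun j hj _ _ _ _ _ => h.not_accused j hj k hk _ rfl,
    fun _ _ _ _ => hl.not_stateLossEvidence,
    fun _ _ _ _ => hl.not_forkIEvidence,
    fun _ _ _ _ _ => hl.not_forkIIEvidence⟩
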